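/- Consider a fully connected network with $L$ layers of widths $n_0=d,n_1,\ldots,n_{L-1},n_L=m$ (all positive), activation $\sigma:\mathbb{R}\to\mathbb{R}$, and training data $X=[x_1,\ldots,x_N]^T\in\mathbb{R}^{N\times d}$. For parameters $\theta=(W_l,b_l)_{l=1}^L\in\Omega=\prod_{l=1}^L\big(\mathbb{R}^{n_{l-1}\times n_l}\times\mathbb{R}^{n_l}\big)$ put $F_0=X$, $F_l=\sigma(F_{l-1}W_l+\mathbf{1}_Nb_l^T)$ (entrywise) for $1\le l\le L-1$, and $F_L(\theta)=F_{L-1}W_L+\mathbf{1}_Nb_L^T$. Let $\varphi:\mathbb{R}^{N\times m}\to\mathbb{R}$ be any convex function, $\Phi(\theta)=\varphi(F_L(\theta))$ the training loss, and $p^*=\inf_{G\in\mathbb{R}^{N\times m}}\varphi(G)\in[-\infty,\infty)$. A local valley of $\Phi$ is a nonempty (path-)connected component of a strict sublevel set $\{\theta\in\Omega:\Phi(\theta)<\alpha\}$, $\alpha\in\mathbb{R}$; it is a bad local valley if $\Phi$ cannot be made arbitrarily close to $p^*$ on it, i.e. if there is a real $c>p^*$ such that $\Phi\ge c$ on it.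 Assume that - $\sigma$ is strictly monotonic (increasing or decreasing) and $\sigma(\mathbb{R})=\mathbb{R}$; - there are no non-zero coefficients $\lambda_1,\ldots,\lambda_p$ and pairwise distinct non-zero shifts $a_1,\ldots,a_p$ such that $\sigma(x)=\sum_{i=1}^p\lambda_i\sigma(x-a_i)$ for every $x\in\mathbb{R}$; - the training samples $x_1,\ldots,x_N$ are distinct; - there is a layer $k\in\{1,\ldots,L-1\}$ such that $n_k\ge N$ and $n_{k+1}>n_{k+2}>\cdots>n_L$. Then: 1. The loss $\Phi$ has no bad local valleys. 2. If $k\le L-2$, then every local valley of $\Phi$ is unbounded. -/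

import Mathlib

namespace NeuralLoss

/-- The parameters `(W, b)` of one layer with `a` inputs and `c` outputs: a weight matrix
`W ∈ ℝ^{a × c}` (given by its entries) and a bias vector `b ∈ ℝ^c`. As a product of finite
powers of `ℝ` it carries the usual topology and the usual notion of boundedness of a
finite-dimensional real vector space. -/
abbrev LayerParams (a c : ℕ) : Type :=
  (Fin a → Fin c → ℝ) × (Fin c → ℝ)

/-- The parameter space `Ω = Ω₁ × ⋯ × Ω_L` of a fully connected network with `L` layers and
widths `n 0, …, n L`. The parameters of layer `l + 1`, which maps `n l` neurons to `n (l + 1)`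
neurons, are stored at the index `l : Fin L`. -/
abbrev Params (L : ℕ) (n : ℕ → ℕ) : Type :=
  ∀ l : Fin L, LayerParams (n l) (n (l + 1))

/-- The affine map of a layer applied to all samples (rows of `F`): `F W + 1_N bᵀ`. -/
def affine {N a c : ℕ} (p : LayerParams a c) (F : Matrix (Fin N) (Fin a) ℝ) :
    Matrix (Fin N) (Fin c) ℝ :=
  F * Matrix.of p.1 + Matrix.of fun _ j => p.2 j

/-- The output `F_k(θ) ∈ ℝ^{N × n_k}` of layer `k`, for `0 ≤ k ≤ L`: `F_0 = X`, and
`F_k = σ (F_{k-1} W_k + 1_N b_kᵀ)` entrywise for `1 ≤ k ≤ L - 1`, while the last layer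
`F_L = F_{L-1} W_L + 1_N b_Lᵀ` has no activation. -/
def layerOutput {L N : ℕ} {n : ℕ → ℕ} (σ : ℝ → ℝ) (X : Matrix (Fin N) (Fin (n 0)) ℝ)
    (θ : Params L n) : (k : ℕ) → k ≤ L → Matrix (Fin N) (Fin (n k)) ℝ
  | 0, _ => X
  | k + 1, h =>
    let Z := affine (θ ⟨k, h⟩) (layerOutput σ X θ k (Nat.le_of_succ_le h))
    if k + 1 = L then Z else Z.map σ

/-- The training loss `Φ(θ) = φ (F_L(θ))`. -/
def trainLoss {L N : ℕ} {n : ℕ → ℕ} (σ : ℝ → ℝ) (X : Matrix (Fin N) (Fin (n 0)) ℝ)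
    (φ : Matrix (Fin N) (Fin (n L)) ℝ → ℝ) (θ : Params L n) : ℝ :=
  φ (layerOutput σ X θ L le_rfl)

/-- `p* = inf_G φ(G)`, taken in the extended reals since it may be `-∞`. -/
noncomputable def optValue {M : Type*} (φ : M → ℝ) : EReal :=
  ⨅ G : M, (φ G : EReal)

/-- `σ` is strictly monotonic (increasing or decreasing) and `σ(ℝ) = ℝ`. -/
def StrictlyMonotonicOnto (σ : ℝ → ℝ) : Prop :=
  (StrictMono σ ∨ StrictAnti σ) ∧ Set.range σ = Set.univ

/-- There are no non-zero coefficients `λ_i` and pairwise distinct non-zero shifts `a_i` with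
`σ(x) = ∑ i, λ_i σ(x - a_i)` for every `x`. (The empty sum only excludes `σ = 0`, for which
there is also a relation with one term.) -/
def NoShiftDependence (σ : ℝ → ℝ) : Prop :=
  ¬ ∃ (p : ℕ) (lam a : Fin p → ℝ), (∀ i, lam i ≠ 0) ∧ (∀ i, a i ≠ 0) ∧
    Function.Injective a ∧ ∀ x : ℝ, σ x = ∑ i, lam i * σ (x - a i)

/-- The strict sublevel set `{θ | Φ(θ) < α}`. -/
def strictSublevel {Ω : Type*} (Φ : Ω → ℝ) (α : ℝ) : Set Ω :=
  {θ | Φ θ < α}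

/-- A local valley: a nonempty connected component of some strict sublevel set, where
connectedness is meant in the sense of continuous paths. -/
def IsLocalValley {Ω : Type*} [TopologicalSpace Ω] (Φ : Ω → ℝ) (C : Set Ω) : Prop :=
  ∃ α : ℝ, ∃ θ ∈ strictSublevel Φ α, C = pathComponentIn (strictSublevel Φ α) θ

/-- `Φ` can be made arbitrarily close to the lower bound `p` on `C` (arbitrarily small if
`p = -∞`). -/
def ArbitrarilyClose {Ω : Type*} (Φ : Ω → ℝ) (p : EReal) (C : Set Ω) : Prop :=
  ∀ c : ℝ, p < (c : EReal) → ∃ θ ∈ C, Φ θ < c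

/-- A bad local valley: a local valley on which `Φ` cannot be made arbitrarily close to `p`. -/
def IsBadLocalValley {Ω : Type*} [TopologicalSpace Ω] (Φ : Ω → ℝ) (p : EReal)
    (C : Set Ω) : Prop :=
  IsLocalValley Φ C ∧ ¬ ArbitrarilyClose Φ p C

end NeuralLoss

/-!
Let `F_l` be the output of layer `l`. When `F_k` has full row rank and the weights above layer `k`
have full column rank, the map from the parameters of layer `k + 1` to `F_l`, `l > k`, has a
continuous right inverse: invert the layers between one at a time. For `l = L` a path in a sublevel
set of the convex `φ` therefore lifts to a path in the sublevel set of the loss. So it is enough to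
reach such parameters inside a given valley, which is open.

* Row rank: for generic parameters the rows of `F_{k-1}` are distinct. If `F_k` is not of full row
  rank, one of its columns is redundant; the outgoing weights can be shifted off that neuron
  without changing `F_L`, after which its incoming weights and bias are free. As the translates of
  `σ` are linearly independent, some choice of them enlarges the column space of `F_k`.
* Column rank: if the ranges of `W` and `V` are independent, some `P` satisfies `P W = W` and
  `P V = 0`. By the right inverse, `F_l` can be moved to `F_l P` without changing `F_l W`, and then
  `W` to `W + V` without changing `F_L`. As the widths decrease, `V` can be chosen to make `W + V`
  injective. Already at layer `k + 1` a rank one `V` is arbitrarily large, so valleys are unbounded.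
-/

open Matrix Set

namespace NeuralLoss

section LinearAlgebra

variable {K ι κ κ' : Type*} [Field K] [Fintype κ]

lemma exists_left_inverse_of_mulVec_injective [Fintype ι] [DecidableEq κ]
    {A : Matrix ι κ K} (hA : Function.Injective A.mulVec) : ∃ Q : Matrix κ ι K, Q * A = 1 := by
  classical
  obtain ⟨g, hg⟩ := A.mulVecLin.exists_leftInverse_of_injective (LinearMap.ker_eq_bot.2 hA)
  refine ⟨LinearMap.toMatrix' g, ?_⟩
  rw [← LinearMap.toMatrix'_toLin' A, ← LinearMap.toMatrix'_comp, toLin'_apply', hg,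
    LinearMap.toMatrix'_id]

lemma exists_mul_eq_self_and_mul_eq_zero [Fintype ι] [Fintype κ'] {W : Matrix ι κ K}
    {V : Matrix ι κ' K} (h : Disjoint (LinearMap.range W.mulVecLin) (LinearMap.range V.mulVecLin)) :
    ∃ P : Matrix ι ι K, P * W = W ∧ P * V = 0 := by
  classical
  obtain ⟨S, hWS, hSV⟩ := h.exists_isCompl
  refine ⟨LinearMap.toMatrix' (S.projection _ hSV), ext_of_mulVec_single fun i => ?_,
    ext_of_mulVec_single fun i => ?_⟩
  · rw [← mulVec_mulVec, LinearMap.toMatrix'_mulVec]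
    exact Submodule.projection_apply_left hSV ⟨_, hWS ⟨_, rfl⟩⟩
  · rw [← mulVec_mulVec, LinearMap.toMatrix'_mulVec, zero_mulVec]
    exact Submodule.projection_apply_eq_zero_iff hSV |>.2 ⟨_, rfl⟩

lemma exists_disjoint_range_and_injective_add {E F : Type*} [AddCommGroup E] [Module K E]
    [FiniteDimensional K E] [AddCommGroup F] [Module K F] [FiniteDimensional K F]
    (h : Module.finrank K E ≤ Module.finrank K F) (f : E →ₗ[K] F) :
    ∃ g : E →ₗ[K] F, Disjoint (LinearMap.range f) (LinearMap.range g) ∧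
      Function.Injective (f + g) := by
  obtain ⟨S, hS⟩ := (LinearMap.range f).exists_isCompl
  have hker : Module.finrank K (LinearMap.ker f) ≤ Module.finrank K S := by
    have h₁ := f.finrank_range_add_finrank_ker
    have h₂ := Submodule.finrank_add_eq_of_isCompl hS
    omega
  obtain ⟨j, hj⟩ := finrank_le_iff_exists_linearMap.1 hker
  obtain ⟨p, hp⟩ := (LinearMap.ker f).subtype.exists_leftInverse_of_injective
    (Submodule.ker_subtype _)
  have hdisj : Disjoint (LinearMap.range f) (LinearMap.range (S.subtype ∘ₗ j ∘ₗ p)) :=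
    hS.disjoint.mono_right (by rintro _ ⟨x, rfl⟩; exact (j (p x)).2)
  refine ⟨S.subtype ∘ₗ j ∘ₗ p, hdisj, (injective_iff_map_eq_zero _).2 fun x hx => ?_⟩
  have hgx : S.subtype (j (p x)) = 0 :=
    Submodule.disjoint_def.1 hdisj _ ⟨-x, by rw [map_neg, neg_eq_of_add_eq_zero_right hx]; rfl⟩
      ⟨x, rfl⟩
  have hfx : f x = 0 := by
    rw [← hx, LinearMap.add_apply, left_eq_add]
    exact hgx
  have hpx : p x = 0 := hj (by simpa using hgx)
  have := congrArg Subtype.val (LinearMap.congr_fun hp ⟨x, hfx⟩)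
  simpa [hpx] using this.symm

lemma disjoint_range_vecMulVec {S : Submodule K (ι → K)} {y : ι → K} (hy : y ∉ S) (v : κ → K) :
    Disjoint S (LinearMap.range (vecMulVec y v).mulVecLin) := by
  have hy₀ : y ≠ 0 := fun h => hy (h ▸ S.zero_mem)
  refine ((Submodule.disjoint_span_singleton' hy₀).2 hy).mono_right ?_
  rintro _ ⟨x, rfl⟩
  rw [mulVecLin_apply, vecMulVec_mulVec, op_smul_eq_smul]
  exact Submodule.smul_mem _ _ (Submodule.mem_span_singleton_self y)

lemma updateCol_mul_of_row_eq_zero [DecidableEq κ] (F : Matrix ι κ K) {j : κ}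
    {B : Matrix κ κ' K} (hB : B j = 0) (u : ι → K) : F.updateCol j u * B = F * B := by
  ext i k
  simp only [mul_apply]
  refine Finset.sum_congr rfl fun c _ => ?_
  by_cases hc : c = j
  · simp [hc, hB]
  · rw [updateCol_ne hc]

lemma exists_mul_eq_self_and_row_eq_zero {F : Matrix ι κ K}
    (hF : ¬ Function.Injective F.mulVec) : ∃ (A : Matrix κ κ K) (j : κ), F * A = F ∧ A j = 0 := by
  classical
  obtain ⟨g, hFg, hg⟩ : ∃ g, F *ᵥ g = 0 ∧ g ≠ 0 := by
    simpa using mt (injective_iff_map_eq_zero F.mulVecLin).2 hF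
  obtain ⟨j, hj⟩ := Function.ne_iff.1 hg
  refine ⟨1 - vecMulVec ((g j)⁻¹ • g) (Pi.single j 1), j, ?_, ?_⟩
  · rw [Matrix.mul_sub, Matrix.mul_one, mul_vecMulVec, mulVec_smul, hFg, smul_zero,
      zero_vecMulVec, sub_zero]
  · ext i
    simp [vecMulVec_apply, one_apply, Pi.single_apply, inv_mul_cancel₀ hj, eq_comm]

lemma range_lt_range_updateCol [DecidableEq κ] {F : Matrix ι κ K} {A : Matrix κ κ K} {j : κ}
    (hFA : F * A = F) (hA : A j = 0) {u : ι → K} (hu : u ∉ LinearMap.range F.mulVecLin) :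
    LinearMap.range F.mulVecLin < LinearMap.range (F.updateCol j u).mulVecLin := by
  have hu' : u ∈ LinearMap.range (F.updateCol j u).mulVecLin :=
    ⟨Pi.single j 1, by ext i; simp⟩
  refine lt_of_le_of_ne ?_ fun h => hu (h ▸ hu')
  calc LinearMap.range F.mulVecLin
      = LinearMap.range (F.updateCol j u * A).mulVecLin := by
        rw [updateCol_mul_of_row_eq_zero F hA, hFA]
    _ ≤ LinearMap.range (F.updateCol j u).mulVecLin := by
        rw [mulVecLin_mul]
        exact LinearMap.range_comp_le_range _ _

lemma exists_injective_dotProduct [Infinite K] {α : Type*} [Finite α] {f : α → κ → K}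
    (hf : Function.Injective f) : ∃ v : κ → K, Function.Injective fun i => f i ⬝ᵥ v := by
  classical
  obtain ⟨g, hg⟩ := Module.exists_dual_forall_apply_ne_zero (K := K)
    (fun q : {q : α × α // q.1 ≠ q.2} => f q.1.1 - f q.1.2)
    (fun q => sub_ne_zero.2 fun h => q.2 (hf h))
  obtain ⟨v, rfl⟩ := (dotProductEquiv K κ).surjective g
  refine ⟨v, fun i i' h => by_contra fun hne => hg ⟨(i, i'), hne⟩ ?_⟩
  simpa [sub_eq_zero, dotProduct_comm v] using h

lemma exists_injective_row_mul [Infinite K] {α : Type*} [Finite α] [Nonempty κ']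
    {F : Matrix α κ K} (hF : Function.Injective F.row) :
    ∃ V : Matrix κ κ' K, Function.Injective (F * V).row := by
  obtain ⟨v, hv⟩ := exists_injective_dotProduct hF
  exact ⟨of fun j _ => v j, fun i i' h => hv (congrFun h (Classical.arbitrary κ'))⟩

lemma finite_setOf_not_injective_add_smul {α E : Type*} [Finite α] [AddCommGroup E] [Module K E]
    (u : α → E) {v : α → E} (hv : Function.Injective v) :
    {t : K | ¬ Function.Injective (u + t • v)}.Finite := by
  have hsub : {t : K | ¬ Function.Injective (u + t • v)} ⊆
      ⋃ q : {q : α × α // q.1 ≠ q.2}, {t | (u + t • v) q.1.1 = (u + t • v) q.1.2} := by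
    intro t ht
    simp only [mem_ofPred_eq, Function.Injective, not_forall] at ht
    obtain ⟨i, i', h, hne⟩ := ht
    exact mem_iUnion.2 ⟨⟨(i, i'), hne⟩, h⟩
  refine (finite_iUnion fun q => Set.Subsingleton.finite fun t ht t' ht' => ?_).subset hsub
  have hne : v q.1.1 - v q.1.2 ≠ 0 := sub_ne_zero.2 fun h => q.2 (hv h)
  simp only [mem_ofPred_eq, Pi.add_apply, Pi.smul_apply] at ht ht'
  have h : (t - t') • (v q.1.1 - v q.1.2) = 0 := by
    linear_combination (norm := module) ht - ht'
  exact sub_eq_zero.1 ((smul_eq_zero.1 h).resolve_right hne)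

end LinearAlgebra

section Translates

variable {σ : ℝ → ℝ}

lemma NoShiftDependence.linearIndependent_translates (hσ : NoShiftDependence σ) :
    LinearIndependent ℝ fun s x : ℝ => σ (x + s) := by
  classical
  rw [linearIndependent_iff']
  intro S c hc s₀ hs₀
  by_contra hcs₀
  set T := {s ∈ S | c s ≠ 0}.erase s₀ with hT
  have hsum : ∀ x, c s₀ * σ (x + s₀) + ∑ s ∈ T, c s * σ (x + s) = 0 := fun x => by
    have h := congrFun hc x
    simp only [Finset.sum_apply, Pi.smul_apply, smul_eq_mul, Pi.zero_apply] at h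
    rw [← h, hT, Finset.add_sum_erase _ (fun s => c s * σ (x + s)) (by simp [hs₀, hcs₀]),
      Finset.sum_filter_of_ne fun s _ => left_ne_zero_of_mul]
  have hmem : ∀ i, (T.equivFin.symm i : ℝ) ≠ s₀ ∧ c (T.equivFin.symm i) ≠ 0 := fun i => by
    have h := (T.equivFin.symm i).2
    simp only [hT, Finset.mem_erase, Finset.mem_filter] at h
    exact ⟨h.1, h.2.2⟩
  refine hσ ⟨T.card, fun i => -(c (T.equivFin.symm i) / c s₀), fun i => s₀ - T.equivFin.symm i,
    fun i => neg_ne_zero.2 (div_ne_zero (hmem i).2 hcs₀), fun i => sub_ne_zero.2 (hmem i).1.symm,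
    fun i i' h => T.equivFin.symm.injective (Subtype.ext (sub_right_injective h)), fun x => ?_⟩
  calc σ x = -(c s₀)⁻¹ * ∑ s ∈ T, c s * σ (x - s₀ + s) := by
        rw [eq_neg_of_add_eq_zero_right (hsum (x - s₀)), sub_add_cancel]
        field_simp
    _ = ∑ s : T, -(c s / c s₀) * σ (x - (s₀ - s)) := by
        rw [← Finset.sum_coe_sort T, Finset.mul_sum]
        refine Finset.sum_congr rfl fun s _ => ?_
        rw [sub_sub_eq_add_sub, add_sub_right_comm]
        ring
    _ = _ := (T.equivFin.symm.sum_comp fun s : T => -(c s / c s₀) * σ (x - (s₀ - s))).symm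

lemma NoShiftDependence.exists_neuron_notMem (hσ : NoShiftDependence σ) {ι κ : Type*} [Finite ι]
    [Fintype κ] {F : Matrix ι κ ℝ} (hF : Function.Injective F.row) {S : Submodule ℝ (ι → ℝ)}
    (hS : S ≠ ⊤) : ∃ (w : κ → ℝ) (b : ℝ), (fun i => σ ((F *ᵥ w) i + b)) ∉ S := by
  classical
  cases nonempty_fintype ι
  obtain ⟨v, hv⟩ := exists_injective_dotProduct hF
  obtain ⟨f, hf, hSf⟩ := S.exists_le_ker_of_lt_top hS.lt_top
  obtain ⟨c, rfl⟩ := (dotProductEquiv ℝ ι).surjective f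
  by_contra! h
  refine hf ?_
  have hc := Fintype.linearIndependent_iff.1
    (hσ.linearIndependent_translates.comp (fun i => F i ⬝ᵥ v) hv) c <| funext fun b => by
      have hb : c ⬝ᵥ (fun i => σ ((F *ᵥ v) i + b)) = 0 := hSf (h v b)
      simpa [dotProduct, mulVec, add_comm b] using hb
  rw [show c = 0 from funext hc, map_zero]

end Translates

section Layers

variable {L N : ℕ} {n : ℕ → ℕ} {X : Matrix (Fin N) (Fin (n 0)) ℝ} {σ : ℝ → ℝ}

/-- The weight matrix `W_{l+1}` of the layer that maps `n l` neurons to `n (l + 1)` neurons. -/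
def weight (θ : Params L n) (l : ℕ) (hl : l < L) : Matrix (Fin (n l)) (Fin (n (l + 1))) ℝ :=
  of (θ ⟨l, hl⟩).1

lemma layerOutput_eq_of_forall_lt {θ θ' : Params L n} {j : ℕ} (hj : j ≤ L)
    (h : ∀ i : Fin L, i < j → θ' i = θ i) : layerOutput σ X θ' j hj = layerOutput σ X θ j hj := by
  induction j with
  | zero => rfl
  | succ j ih =>
    simp only [layerOutput, h ⟨j, hj⟩ j.lt_succ_self,
      ih (Nat.le_of_succ_le hj) fun i hi => h i (hi.trans j.lt_succ_self)]

lemma layerOutput_eq_of_forall_ge {θ θ' : Params L n} {j l : ℕ} (hjl : j ≤ l) (hl : l ≤ L)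
    (hj : layerOutput σ X θ' j (hjl.trans hl) = layerOutput σ X θ j (hjl.trans hl))
    (h : ∀ i : Fin L, j ≤ i → θ' i = θ i) :
    layerOutput σ X θ' l hl = layerOutput σ X θ l hl := by
  induction l, hjl using Nat.le_induction with
  | base => exact hj
  | succ l hjl ih => simp only [layerOutput, h ⟨l, hl⟩ hjl, ih (Nat.le_of_succ_le hl) hj]

lemma update_of_val_ne (θ : Params L n) {l : ℕ} (hl : l < L) (p : LayerParams (n l) (n (l + 1)))
    {i : Fin L} (hi : (i : ℕ) ≠ l) : Function.update θ ⟨l, hl⟩ p i = θ i :=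
  Function.update_of_ne (Fin.ne_of_val_ne hi) _ _

lemma layerOutput_update_of_le (θ : Params L n) {l : ℕ} (hl : l < L)
    (p : LayerParams (n l) (n (l + 1))) {j : ℕ} (hj : j ≤ L) (hjl : j ≤ l) :
    layerOutput σ X (Function.update θ ⟨l, hl⟩ p) j hj = layerOutput σ X θ j hj :=
  layerOutput_eq_of_forall_lt hj fun _ hi => update_of_val_ne θ hl p (hi.trans_le hjl).ne

lemma layerOutput_update_eq_of_affine_eq (θ : Params L n) {l j : ℕ} (hl : l < L)
    {p : LayerParams (n l) (n (l + 1))} (hlj : l < j) (hj : j ≤ L)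
    (hp : affine p (layerOutput σ X θ l hl.le) =
      affine (θ ⟨l, hl⟩) (layerOutput σ X θ l hl.le)) :
    layerOutput σ X (Function.update θ ⟨l, hl⟩ p) j hj = layerOutput σ X θ j hj := by
  refine layerOutput_eq_of_forall_ge (j := l + 1) hlj hj ?_
    fun i hi => update_of_val_ne θ hl p (by omega)
  simp only [layerOutput, layerOutput_update_of_le θ hl p hl.le le_rfl, Function.update_self, hp]

section Affine

variable {a c : ℕ}

lemma affine_add_mul {p : LayerParams a c} {Q : Matrix (Fin c) (Fin a) ℝ} (hQ : Q * of p.1 = 1)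
    (F : Matrix (Fin N) (Fin a) ℝ) (D : Matrix (Fin N) (Fin c) ℝ) :
    affine p (F + D * Q) = affine p F + D := by
  rw [affine, affine, Matrix.add_mul, Matrix.mul_assoc, hQ, Matrix.mul_one, add_right_comm]

lemma continuous_affine : Continuous fun q : LayerParams a c × Matrix (Fin N) (Fin a) ℝ =>
    affine q.1 q.2 := by
  refine (continuous_snd.matrix_mul continuous_fst.fst).add ?_
  exact continuous_matrix fun _ j => (continuous_apply j).comp continuous_fst.snd

/-- The layer obtained from `p` by adding `V` to its weight matrix. -/
def addWeight (p : LayerParams a c) (V : Matrix (Fin a) (Fin c) ℝ) : LayerParams a c :=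
  (of.symm (of p.1 + V), p.2)

lemma addWeight_zero (p : LayerParams a c) : addWeight p 0 = p := by
  rw [addWeight, add_zero, Equiv.symm_apply_apply]

lemma affine_addWeight (p : LayerParams a c) (V : Matrix (Fin a) (Fin c) ℝ)
    (F : Matrix (Fin N) (Fin a) ℝ) : affine (addWeight p V) F = affine p F + F * V := by
  rw [affine, affine, addWeight, Equiv.apply_symm_apply, Matrix.mul_add, add_right_comm]

lemma continuous_addWeight (p : LayerParams a c) :
    Continuous fun V : Matrix (Fin a) (Fin c) ℝ => addWeight p V :=
  (continuous_const.add continuous_id).prodMk continuous_const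

/-- The layer obtained from `p` by giving neuron `j` the input weights `w` and the bias `b`. -/
def setNeuron (p : LayerParams a c) (j : Fin c) (w : Fin a → ℝ) (b : ℝ) : LayerParams a c :=
  ((of p.1).updateCol j w, Function.update p.2 j b)

lemma setNeuron_self (p : LayerParams a c) (j : Fin c) :
    setNeuron p j ((of p.1).col j) (p.2 j) = p :=
  Prod.ext (updateCol_eq_self _ j) (Function.update_eq_self j _)

lemma continuous_setNeuron (p : LayerParams a c) (j : Fin c) :
    Continuous fun q : (Fin a → ℝ) × ℝ => setNeuron p j q.1 q.2 :=
  .prodMk (continuous_const.matrix_updateCol j continuous_fst)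
    (continuous_const.update j continuous_snd)

lemma affine_setNeuron (p : LayerParams a c) (j : Fin c) (w : Fin a → ℝ) (b : ℝ)
    (F : Matrix (Fin N) (Fin a) ℝ) :
    affine (setNeuron p j w b) F = (affine p F).updateCol j fun i => (F *ᵥ w) i + b := by
  change F * (of p.1).updateCol j w + of (fun _ i => Function.update p.2 j b i) = _
  rw [mul_updateCol]
  ext i k
  by_cases hk : k = j
  · subst hk
    simp
  · simp [hk, affine]

end Affine

lemma continuous_layerOutput (hσ : Continuous σ) {j : ℕ} (hj : j ≤ L) :
    Continuous fun θ : Params L n => layerOutput σ X θ j hj := by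
  induction j with
  | zero => exact continuous_const
  | succ j ih =>
    have hZ : Continuous fun θ : Params L n =>
        affine (θ ⟨j, hj⟩) (layerOutput σ X θ j (Nat.le_of_succ_le hj)) :=
      continuous_affine.comp (f := fun θ : Params L n => (θ ⟨j, hj⟩, layerOutput σ X θ j _))
        ((continuous_apply _).prodMk (ih (Nat.le_of_succ_le hj)))
    by_cases hjL : j + 1 = L
    · simpa only [layerOutput, if_pos hjL] using hZ
    · simpa only [layerOutput, if_neg hjL] using hZ.matrix_map hσ

end Layers

section Activation

variable {L N : ℕ} {n : ℕ → ℕ} {X : Matrix (Fin N) (Fin (n 0)) ℝ} (e : ℝ ≃ₜ ℝ)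

lemma StrictlyMonotonicOnto.exists_homeomorph_coe_eq {σ : ℝ → ℝ} (hσ : StrictlyMonotonicOnto σ) :
    ∃ e : ℝ ≃ₜ ℝ, ⇑e = σ := by
  obtain ⟨hmono | hanti, hrange⟩ := hσ
  · exact ⟨(hmono.orderIsoOfSurjective σ (range_eq_univ.1 hrange)).toHomeomorph, rfl⟩
  · have hneg : StrictMono (-σ) := fun x y h => neg_lt_neg (hanti h)
    have hsurj : Function.Surjective (-σ) := neg_surjective.comp (range_eq_univ.1 hrange)
    exact ⟨(hneg.orderIsoOfSurjective _ hsurj).toHomeomorph.trans (Homeomorph.neg ℝ),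
      funext fun x => neg_neg (σ x)⟩

/-- The map from the preactivation to the output of layer `j` of a network with `L` layers whose
activation is the homeomorphism `e`: `e` entrywise, or the identity if `j = L`. -/
def layerActivation (L j : ℕ) {c : ℕ} :
    Matrix (Fin N) (Fin c) ℝ ≃ₜ Matrix (Fin N) (Fin c) ℝ :=
  if j = L then .refl _ else
    { toEquiv := e.toEquiv.mapMatrix
      continuous_toFun := continuous_id.matrix_map e.continuous
      continuous_invFun := continuous_id.matrix_map e.symm.continuous }

lemma layerActivation_of_ne {j c : ℕ} (hj : j ≠ L) (Z : Matrix (Fin N) (Fin c) ℝ) :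
    layerActivation e L j Z = Z.map e := by
  rw [layerActivation, if_neg hj]
  rfl

lemma injective_row_layerActivation {j c : ℕ} {Z : Matrix (Fin N) (Fin c) ℝ}
    (hZ : Function.Injective Z.row) : Function.Injective (layerActivation e L j Z).row := by
  by_cases hj : j = L
  · rwa [layerActivation, if_pos hj]
  · rw [layerActivation_of_ne e hj]
    exact e.injective.comp_left.comp hZ

lemma layerOutput_succ (θ : Params L n) {j : ℕ} (hj : j + 1 ≤ L) :
    layerOutput e X θ (j + 1) hj = layerActivation e L (j + 1)
      (affine (θ ⟨j, hj⟩) (layerOutput e X θ j (Nat.le_of_succ_le hj))) := by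
  by_cases h : j + 1 = L
  · simp only [layerOutput, layerActivation, if_pos h]
    rfl
  · simp only [layerOutput, layerActivation, if_neg h]
    rfl

lemma layerOutput_update_succ (θ : Params L n) {l : ℕ} (hl : l < L)
    (p : LayerParams (n l) (n (l + 1))) :
    layerOutput e X (Function.update θ ⟨l, hl⟩ p) (l + 1) hl =
      layerActivation e L (l + 1) (affine p (layerOutput e X θ l hl.le)) := by
  rw [layerOutput_succ, layerOutput_update_of_le θ hl p _ le_rfl, Function.update_self]

lemma layerOutput_update_setNeuron (θ : Params L n) {l : ℕ} (hl : l < L) (hl' : l + 1 ≠ L)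
    (j : Fin (n (l + 1))) (w : Fin (n l) → ℝ) (b : ℝ) :
    layerOutput e X (Function.update θ ⟨l, hl⟩ (setNeuron (θ ⟨l, hl⟩) j w b)) (l + 1) hl =
      (layerOutput e X θ (l + 1) hl).updateCol j
        fun i => e ((layerOutput e X θ l hl.le *ᵥ w) i + b) := by
  rw [layerOutput_update_succ, layerOutput_succ, affine_setNeuron, layerActivation_of_ne e hl',
    layerActivation_of_ne e hl', map_updateCol]
  rfl

end Activation

section OutputJoined

variable {L N : ℕ} {n : ℕ → ℕ} {X : Matrix (Fin N) (Fin (n 0)) ℝ} {σ : ℝ → ℝ}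

/-- Two parameters are output-joined if some path between them keeps the network output `F_L`
constant. Local valleys of every training loss are closed under this relation. -/
def OutputJoined (σ : ℝ → ℝ) (X : Matrix (Fin N) (Fin (n 0)) ℝ) (θ θ' : Params L n) : Prop :=
  JoinedIn {η | layerOutput σ X η L le_rfl = layerOutput σ X θ L le_rfl} θ θ'

lemma OutputJoined.refl (θ : Params L n) : OutputJoined σ X θ θ :=
  JoinedIn.refl rfl

lemma OutputJoined.layerOutput_eq {θ θ' : Params L n} (h : OutputJoined σ X θ θ') :
    layerOutput σ X θ' L le_rfl = layerOutput σ X θ L le_rfl :=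
  h.target_mem

lemma OutputJoined.trans {θ₁ θ₂ θ₃ : Params L n} (h₁₂ : OutputJoined σ X θ₁ θ₂)
    (h₂₃ : OutputJoined σ X θ₂ θ₃) : OutputJoined σ X θ₁ θ₃ :=
  JoinedIn.trans h₁₂ (h₂₃.mono fun _ h => Eq.trans h h₁₂.layerOutput_eq)

lemma outputJoined_of_continuous {Y : Type*} [TopologicalSpace Y] [PathConnectedSpace Y]
    {f : Y → Params L n} (hf : Continuous f) {G : Matrix (Fin N) (Fin (n L)) ℝ}
    (hG : ∀ y, layerOutput σ X (f y) L le_rfl = G) (y y' : Y) : OutputJoined σ X (f y) (f y') :=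
  ⟨(PathConnectedSpace.somePath y y').map hf, fun _ => (hG _).trans (hG y).symm⟩

lemma outputJoined_update_add (θ : Params L n) {l : ℕ} (hl : l < L)
    {V : Matrix (Fin (n l)) (Fin (n (l + 1))) ℝ} (hV : layerOutput σ X θ l hl.le * V = 0) :
    OutputJoined σ X θ (Function.update θ ⟨l, hl⟩ (addWeight (θ ⟨l, hl⟩) V)) := by
  have hf : Continuous fun t : ℝ =>
      Function.update θ ⟨l, hl⟩ (addWeight (θ ⟨l, hl⟩) (t • V)) :=
    continuous_const.update _
      ((continuous_addWeight _).comp (continuous_id.smul continuous_const))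
  have h := outputJoined_of_continuous (σ := σ) (X := X) hf
    (fun t => layerOutput_update_eq_of_affine_eq θ hl hl le_rfl <| by
      rw [affine_addWeight, Matrix.mul_smul, hV, smul_zero, add_zero]) 0 1
  rwa [zero_smul, one_smul, addWeight_zero, Function.update_eq_self] at h

lemma outputJoined_update_setNeuron (e : ℝ ≃ₜ ℝ) (θ : Params L n) {l : ℕ} (hl : l + 1 < L)
    {j : Fin (n (l + 1))} (hj : weight θ (l + 1) hl j = 0) (w : Fin (n l) → ℝ) (b : ℝ) :
    OutputJoined e X θ (Function.update θ ⟨l, l.lt_succ_self.trans hl⟩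
      (setNeuron (θ ⟨l, l.lt_succ_self.trans hl⟩) j w b)) := by
  have hl₀ : l < L := l.lt_succ_self.trans hl
  have hout : ∀ q : (Fin (n l) → ℝ) × ℝ, layerOutput e X
      (Function.update θ ⟨l, hl₀⟩ (setNeuron (θ ⟨l, hl₀⟩) j q.1 q.2)) L le_rfl =
        layerOutput e X θ L le_rfl := fun q => by
    refine layerOutput_eq_of_forall_ge (j := l + 2) hl le_rfl ?_
      fun i hi => update_of_val_ne θ hl₀ _ (by omega)
    rw [layerOutput_succ, layerOutput_update_setNeuron e θ hl₀ hl.ne, layerOutput_succ e θ hl,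
      update_of_val_ne θ hl₀ _ (by simp), affine, affine,
      updateCol_mul_of_row_eq_zero _ (B := of _) hj]
  have h := outputJoined_of_continuous
    (continuous_const.update (⟨l, hl₀⟩ : Fin L) (continuous_setNeuron (θ ⟨l, hl₀⟩) j)) hout
    ((of (θ ⟨l, hl₀⟩).1).col j, (θ ⟨l, hl₀⟩).2 j) (w, b)
  rwa [setNeuron_self, Function.update_eq_self] at h

end OutputJoined

section ContinuousSection

variable {L N : ℕ} {n : ℕ → ℕ} {X : Matrix (Fin N) (Fin (n 0)) ℝ} {e : ℝ ≃ₜ ℝ}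

lemma exists_continuous_section_succ (θ : Params L n) {k : ℕ} (hkL : k < L)
    (hk : Function.Surjective (layerOutput e X θ k hkL.le).mulVec) :
    ∃ s : Matrix (Fin N) (Fin (n (k + 1))) ℝ → LayerParams (n k) (n (k + 1)),
      Continuous s ∧ s (layerOutput e X θ (k + 1) hkL) = θ ⟨k, hkL⟩ ∧
      ∀ G, layerOutput e X (Function.update θ ⟨k, hkL⟩ (s G)) (k + 1) hkL = G := by
  obtain ⟨R, hR⟩ := mulVec_surjective_iff_exists_right_inverse.1 hk
  let Z := affine (θ ⟨k, hkL⟩) (layerOutput e X θ k hkL.le)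
  refine ⟨fun G => addWeight (θ ⟨k, hkL⟩) (R * ((layerActivation e L (k + 1)).symm G - Z)),
    ?_, ?_, fun G => ?_⟩
  · exact (continuous_addWeight _).comp (continuous_const.matrix_mul
      ((Homeomorph.continuous _).sub continuous_const))
  · dsimp only
    rw [layerOutput_succ, Homeomorph.symm_apply_apply, sub_self, Matrix.mul_zero, addWeight_zero]
  · rw [layerOutput_update_succ, affine_addWeight, ← Matrix.mul_assoc, hR, Matrix.one_mul,
      add_sub_cancel, Homeomorph.apply_symm_apply]

lemma exists_continuous_section (θ : Params L n) {k l : ℕ} (hkl : k < l) (hl : l ≤ L)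
    (hk : Function.Surjective (layerOutput e X θ k (hkl.le.trans hl)).mulVec)
    (hW : ∀ j (hj : j < L), k < j → j < l → Function.Injective (weight θ j hj).mulVec) :
    ∃ s : Matrix (Fin N) (Fin (n l)) ℝ → LayerParams (n k) (n (k + 1)),
      Continuous s ∧ s (layerOutput e X θ l hl) = θ ⟨k, hkl.trans_le hl⟩ ∧
      ∀ G, layerOutput e X (Function.update θ ⟨k, hkl.trans_le hl⟩ (s G)) l hl = G := by
  induction l, hkl using Nat.le_induction with
  | base => exact exists_continuous_section_succ θ hl hk
  | succ l hkl ih =>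
    obtain ⟨s, hs, hsθ, hsG⟩ := ih (Nat.le_of_succ_le hl) hk
      fun j hj hkj hjl => hW j hj hkj (hjl.trans l.lt_succ_self)
    obtain ⟨Q, hQ⟩ := exists_left_inverse_of_mulVec_injective (hW l hl hkl l.lt_succ_self)
    let F := layerOutput e X θ l (Nat.le_of_succ_le hl)
    refine ⟨fun G => s (F + ((layerActivation e L (l + 1)).symm G - affine (θ ⟨l, hl⟩) F) * Q),
      ?_, ?_, fun G => ?_⟩
    · exact hs.comp (continuous_const.add
        (((Homeomorph.continuous _).sub continuous_const).matrix_mul continuous_const))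
    · dsimp only
      rw [layerOutput_succ, Homeomorph.symm_apply_apply, sub_self, Matrix.zero_mul, add_zero, hsθ]
    · rw [layerOutput_succ, hsG, update_of_val_ne θ _ _ (Nat.ne_of_gt hkl), affine_add_mul hQ,
        add_sub_cancel, Homeomorph.apply_symm_apply]

end ContinuousSection

section FullRank

variable {L N : ℕ} {n : ℕ → ℕ} {X : Matrix (Fin N) (Fin (n 0)) ℝ} {e : ℝ ≃ₜ ℝ}

lemma weight_update_of_ne (θ : Params L n) {l j : ℕ} (hl : l < L)
    (p : LayerParams (n l) (n (l + 1))) (hj : j < L) (hjl : j ≠ l) :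
    weight (Function.update θ ⟨l, hl⟩ p) j hj = weight θ j hj := by
  rw [weight, weight, update_of_val_ne θ hl p hjl]

lemma weight_update_addWeight (θ : Params L n) {l : ℕ} (hl : l < L)
    (p : LayerParams (n l) (n (l + 1))) (V : Matrix (Fin (n l)) (Fin (n (l + 1))) ℝ) :
    weight (Function.update θ ⟨l, hl⟩ (addWeight p V)) l hl = of p.1 + V := by
  rw [weight, Function.update_self, addWeight, Equiv.apply_symm_apply]

lemma exists_outputJoined_addWeight (θ : Params L n) {k l : ℕ} (hkl : k < l) (hl : l < L)
    (hk : Function.Surjective (layerOutput e X θ k (hkl.trans hl).le).mulVec)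
    (hW : ∀ j (hj : j < L), k < j → j < l → Function.Injective (weight θ j hj).mulVec)
    {V : Matrix (Fin (n l)) (Fin (n (l + 1))) ℝ}
    (hV : Disjoint (LinearMap.range (weight θ l hl).mulVecLin) (LinearMap.range V.mulVecLin)) :
    ∃ p, OutputJoined e X θ (Function.update (Function.update θ ⟨k, hkl.trans hl⟩ p) ⟨l, hl⟩
      (addWeight (θ ⟨l, hl⟩) V)) := by
  obtain ⟨P, hPW, hPV⟩ := exists_mul_eq_self_and_mul_eq_zero hV
  obtain ⟨s, hs, hsθ, hsG⟩ := exists_continuous_section θ hkl hl.le hk hW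
  set F := layerOutput e X θ l hl.le
  have hFW : (F * P - F) * weight θ l hl = 0 := by
    rw [Matrix.sub_mul, Matrix.mul_assoc, hPW, sub_self]
  have hf : Continuous fun t : ℝ =>
      Function.update θ ⟨k, hkl.trans hl⟩ (s (F + t • (F * P - F))) :=
    continuous_const.update _
      (hs.comp (continuous_const.add (continuous_id.smul continuous_const)))
  have hjoin := outputJoined_of_continuous (σ := e) (X := X) hf (fun t =>
    layerOutput_eq_of_forall_ge (j := l + 1) (θ := θ) hl le_rfl (by
      rw [layerOutput_succ, layerOutput_succ, hsG, update_of_val_ne θ _ _ hkl.ne', affine, affine,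
        Matrix.add_mul, Matrix.smul_mul, ← weight, hFW, smul_zero, add_zero])
      fun i hi => update_of_val_ne θ _ _ (by omega)) 0 1
  rw [zero_smul, one_smul, add_zero, hsθ, Function.update_eq_self, add_sub_cancel] at hjoin
  have hadd := outputJoined_update_add (σ := e) (X := X)
    (Function.update θ ⟨k, hkl.trans hl⟩ (s (F * P))) hl (V := V) (by
      rw [hsG, Matrix.mul_assoc, hPV, Matrix.mul_zero])
  rw [update_of_val_ne θ _ _ hkl.ne'] at hadd
  exact ⟨_, hjoin.trans hadd⟩

lemma exists_outputJoined_injective_weight (θ : Params L n) {k l : ℕ} (hkl : k < l) (hl : l ≤ L)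
    (hk : Function.Surjective (layerOutput e X θ k (hkl.le.trans hl)).mulVec)
    (hn : ∀ j, k < j → j < l → n (j + 1) ≤ n j) :
    ∃ θ', OutputJoined e X θ θ' ∧
      layerOutput e X θ' k (hkl.le.trans hl) = layerOutput e X θ k (hkl.le.trans hl) ∧
      ∀ j (hj : j < L), k < j → j < l → Function.Injective (weight θ' j hj).mulVec := by
  induction l, hkl using Nat.le_induction with
  | base => exact ⟨θ, .refl θ, rfl, fun j _ hkj hjk => by omega⟩
  | succ l hkl ih =>
    obtain ⟨θ₁, hjoin, hθ₁, hW⟩ := ih (Nat.le_of_succ_le hl) hk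
      fun j hkj hjl => hn j hkj (hjl.trans l.lt_succ_self)
    obtain ⟨g, hdisj, hinj⟩ := exists_disjoint_range_and_injective_add
      (by simpa using hn l hkl l.lt_succ_self) (weight θ₁ l hl).mulVecLin
    obtain ⟨V, rfl⟩ := toLin'.surjective g
    obtain ⟨p, hp⟩ := exists_outputJoined_addWeight θ₁ hkl hl (hθ₁ ▸ hk) hW hdisj
    refine ⟨_, hjoin.trans hp, ?_, fun j hj hkj hjl => ?_⟩
    · rw [layerOutput_update_of_le _ _ _ _ (Nat.le_of_succ_le hkl),
        layerOutput_update_of_le _ _ _ _ le_rfl, hθ₁]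
    · obtain rfl | hne := eq_or_ne j l
      · rw [weight_update_addWeight]
        rwa [toLin'_apply', ← mulVecLin_add] at hinj
      · rw [weight_update_of_ne _ _ _ _ hne, weight_update_of_ne _ _ _ _ hkj.ne']
        exact hW j hj hkj (by omega)

lemma dense_setOf_injective_row_layerOutput (hX : Function.Injective X.row) {l : ℕ} (hl : l ≤ L)
    (hn : ∀ j < l, 0 < n (j + 1)) :
    Dense {θ : Params L n | Function.Injective (layerOutput e X θ l hl).row} := by
  induction l with
  | zero => simp only [layerOutput, hX, ofPred_true, dense_univ]
  | succ l ih =>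
    refine dense_iff_inter_open.2 fun U hU hne => ?_
    obtain ⟨θ, hθU, hθ⟩ := (ih (Nat.le_of_succ_le hl)
      fun j hj => hn j (hj.trans l.lt_succ_self)).inter_open_nonempty U hU hne
    have : Nonempty (Fin (n (l + 1))) := ⟨⟨0, hn l l.lt_succ_self⟩⟩
    obtain ⟨V, hV⟩ := exists_injective_row_mul (κ' := Fin (n (l + 1))) hθ
    have hf : Continuous fun t : ℝ =>
        Function.update θ ⟨l, hl⟩ (addWeight (θ ⟨l, hl⟩) (t • V)) :=
      continuous_const.update _
        ((continuous_addWeight _).comp (continuous_id.smul continuous_const))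
    have hU₀ : {t : ℝ | Function.update θ ⟨l, hl⟩ (addWeight (θ ⟨l, hl⟩) (t • V)) ∈ U} ∈
        nhds (0 : ℝ) := (hU.preimage hf).mem_nhds <| by
      rwa [mem_preimage, zero_smul, addWeight_zero, Function.update_eq_self]
    obtain ⟨t, htU, ht⟩ := (infinite_of_mem_nhds 0 hU₀).exists_notMem_finite
      (finite_setOf_not_injective_add_smul
        (affine (θ ⟨l, hl⟩) (layerOutput e X θ l (Nat.le_of_succ_le hl))).row hV)
    refine ⟨_, htU, ?_⟩
    rw [mem_ofPred_eq, layerOutput_update_succ, affine_addWeight, Matrix.mul_smul]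
    exact injective_row_layerActivation e (not_not.1 ht)

lemma exists_outputJoined_range_lt (he : NoShiftDependence e) (θ : Params L n) {l : ℕ}
    (hl : l + 1 < L) (hF : Function.Injective (layerOutput e X θ l (Nat.lt_of_succ_lt hl).le).row)
    (hN : N ≤ n (l + 1))
    (hsurj : ¬ Function.Surjective (layerOutput e X θ (l + 1) hl.le).mulVec) :
    ∃ θ', OutputJoined e X θ θ' ∧
      layerOutput e X θ' l (Nat.lt_of_succ_lt hl).le =
        layerOutput e X θ l (Nat.lt_of_succ_lt hl).le ∧
      LinearMap.range (layerOutput e X θ (l + 1) hl.le).mulVecLin <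
        LinearMap.range (layerOutput e X θ' (l + 1) hl.le).mulVecLin := by
  have hl₀ : l < L := l.lt_succ_self.trans hl
  set G := layerOutput e X θ (l + 1) hl.le
  have hinj : ¬ Function.Injective G.mulVec := fun h => hsurj <|
    (LinearMap.injective_iff_surjective_of_finrank_eq_finrank (f := G.mulVecLin)
      (le_antisymm (LinearMap.finrank_le_finrank_of_injective (f := G.mulVecLin) h)
        (by simpa using hN))).1 h
  obtain ⟨A, j, hGA, hA⟩ := exists_mul_eq_self_and_row_eq_zero hinj
  let W := weight θ (l + 1) hl
  let θ₁ := Function.update θ ⟨l + 1, hl⟩ (addWeight (θ ⟨l + 1, hl⟩) (A * W - W))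
  have hθ₁ : OutputJoined e X θ θ₁ := outputJoined_update_add θ hl (by
    rw [Matrix.mul_sub, ← Matrix.mul_assoc, hGA, sub_self])
  have hrow : weight θ₁ (l + 1) hl j = 0 := by
    rw [weight_update_addWeight, ← weight, add_sub_cancel, mul_apply_eq_vecMul]
    exact hA ▸ zero_vecMul W
  have hFθ₁ : layerOutput e X θ₁ l hl₀.le = layerOutput e X θ l hl₀.le :=
    layerOutput_update_of_le _ _ _ _ l.le_succ
  have hGθ₁ : layerOutput e X θ₁ (l + 1) hl.le = G :=
    layerOutput_update_of_le _ _ _ _ le_rfl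
  obtain ⟨w, b, hwb⟩ := he.exists_neuron_notMem hF
    (mt LinearMap.range_eq_top.1 hsurj : LinearMap.range G.mulVecLin ≠ ⊤)
  refine ⟨_, hθ₁.trans (outputJoined_update_setNeuron e θ₁ hl hrow w b), ?_, ?_⟩
  · rw [layerOutput_update_of_le _ _ _ _ le_rfl, hFθ₁]
  · rw [layerOutput_update_setNeuron e θ₁ hl₀ hl.ne, hGθ₁, hFθ₁]
    exact range_lt_range_updateCol hGA hA hwb

lemma exists_outputJoined_surjective_mulVec (he : NoShiftDependence e) (θ : Params L n) {l : ℕ}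
    (hl : l + 1 < L) (hF : Function.Injective (layerOutput e X θ l (Nat.lt_of_succ_lt hl).le).row)
    (hN : N ≤ n (l + 1)) :
    ∃ θ', OutputJoined e X θ θ' ∧
      Function.Surjective (layerOutput e X θ' (l + 1) hl.le).mulVec := by
  induction h : LinearMap.range (layerOutput e X θ (l + 1) hl.le).mulVecLin
    using WellFoundedGT.induction generalizing θ with
  | ind R ih =>
    by_cases hsurj : Function.Surjective (layerOutput e X θ (l + 1) hl.le).mulVec
    · exact ⟨θ, .refl θ, hsurj⟩
    · obtain ⟨θ₁, hjoin₁, hθ₁, hlt⟩ := exists_outputJoined_range_lt he θ hl hF hN hsurj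
      obtain ⟨θ₂, hjoin₂, hθ₂⟩ := ih _ (h ▸ hlt) θ₁ (hθ₁ ▸ hF) rfl
      exact ⟨θ₂, hjoin₁.trans hjoin₂, hθ₂⟩

end FullRank

section LocalValleys

variable {Ω : Type*} [TopologicalSpace Ω] {Φ : Ω → ℝ} {C : Set Ω}

lemma IsLocalValley.exists_eq_pathComponentIn (hC : IsLocalValley Φ C) {x : Ω} (hx : x ∈ C) :
    ∃ α, Φ x < α ∧ C = pathComponentIn (strictSublevel Φ α) x := by
  obtain ⟨α, x₀, -, rfl⟩ := hC
  exact ⟨α, hx.target_mem, (pathComponentIn_congr hx).symm⟩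

lemma IsLocalValley.isOpen [LocallyPathConnectedSpace Ω] (hΦ : Continuous Φ)
    (hC : IsLocalValley Φ C) : IsOpen C := by
  obtain ⟨α, x₀, -, rfl⟩ := hC
  exact (isOpen_lt hΦ continuous_const).pathComponentIn x₀

lemma IsLocalValley.nonempty (hC : IsLocalValley Φ C) : C.Nonempty := by
  obtain ⟨α, x₀, hx₀, rfl⟩ := hC
  exact ⟨x₀, mem_pathComponentIn_self hx₀⟩

lemma not_isBadLocalValley_of_convexOn [AddCommGroup Ω] [Module ℝ Ω] [ContinuousAdd Ω]
    [ContinuousSMul ℝ Ω] (hΦ : ConvexOn ℝ univ Φ) : ¬ IsBadLocalValley Φ (optValue Φ) C := by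
  rintro ⟨⟨α, x, hx, rfl⟩, hbad⟩
  refine hbad fun c hc => ?_
  obtain ⟨y, hy⟩ := iInf_lt_iff.1 hc
  rw [EReal.coe_lt_coe_iff] at hy
  obtain hyα | hαy := lt_or_ge (Φ y) α
  · have hconv : Convex ℝ (strictSublevel Φ α) := by
      simpa [strictSublevel] using hΦ.convex_lt α
    exact ⟨y, (hconv.isPathConnected ⟨x, hx⟩).joinedIn x hx y hyα, hy⟩
  · exact ⟨x, mem_pathComponentIn_self hx, (lt_of_lt_of_le hx hαy).trans hy⟩

end LocalValleys

section TrainLoss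

variable {L N : ℕ} {n : ℕ → ℕ} {X : Matrix (Fin N) (Fin (n 0)) ℝ} {σ : ℝ → ℝ} {e : ℝ ≃ₜ ℝ}
  {φ : Matrix (Fin N) (Fin (n L)) ℝ → ℝ} {C : Set (Params L n)} {θ θ' : Params L n}

lemma IsLocalValley.mem_of_outputJoined (hC : IsLocalValley (trainLoss σ X φ) C) (hθ : θ ∈ C)
    (h : OutputJoined σ X θ θ') : θ' ∈ C := by
  obtain ⟨α, hα, rfl⟩ := hC.exists_eq_pathComponentIn hθ
  exact h.mono fun η (hη : layerOutput σ X η L le_rfl = _) => by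
    rwa [strictSublevel, mem_ofPred_eq, trainLoss, hη]

lemma IsLocalValley.exists_mem_surjective_mulVec (he : NoShiftDependence e)
    (hφ : Continuous φ) (hX : Function.Injective X.row) {l : ℕ} (hl : l + 1 < L)
    (hn : ∀ j < l, 0 < n (j + 1)) (hN : N ≤ n (l + 1))
    (hC : IsLocalValley (trainLoss e X φ) C) :
    ∃ θ ∈ C, Function.Surjective (layerOutput e X θ (l + 1) hl.le).mulVec := by
  obtain ⟨θ, hθC, hθ⟩ := (dense_setOf_injective_row_layerOutput hX (Nat.lt_of_succ_lt hl).le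
    hn).inter_open_nonempty C (hC.isOpen (hφ.comp (continuous_layerOutput e.continuous le_rfl)))
      hC.nonempty
  obtain ⟨θ', hjoin, hθ'⟩ := exists_outputJoined_surjective_mulVec he θ hl hθ hN
  exact ⟨θ', hC.mem_of_outputJoined hθC hjoin, hθ'⟩

lemma IsLocalValley.arbitrarilyClose (hC : IsLocalValley (trainLoss e X φ) C) (hθ : θ ∈ C)
    {k : ℕ} (hkL : k < L) (hk : Function.Surjective (layerOutput e X θ k hkL.le).mulVec)
    (hW : ∀ j (hj : j < L), k < j → Function.Injective (weight θ j hj).mulVec) {p : EReal}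
    (hφ : ∀ D, ¬ IsBadLocalValley φ p D) : ArbitrarilyClose (trainLoss e X φ) p C := by
  intro c hc
  obtain ⟨s, hs, hsθ, hsG⟩ := exists_continuous_section θ hkL le_rfl hk
    fun j hj hkj _ => hW j hj hkj
  obtain ⟨α, hα, rfl⟩ := hC.exists_eq_pathComponentIn hθ
  obtain ⟨G, hG, hGc⟩ : ∃ G ∈ pathComponentIn (strictSublevel φ α)
      (layerOutput e X θ L le_rfl), φ G < c :=
    not_not.1 (fun h => hφ _ ⟨⟨α, _, hα, rfl⟩, h⟩) c hc
  have hloss : ∀ G, trainLoss e X φ (Function.update θ ⟨k, hkL⟩ (s G)) = φ G := fun G => by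
    rw [trainLoss, hsG]
  obtain ⟨γ, hγ⟩ := hG
  have hlift : Continuous fun G => Function.update θ ⟨k, hkL⟩ (s G) :=
    continuous_const.update _ hs
  refine ⟨_, ⟨(γ.map hlift).cast ?_ rfl, fun t => (hloss (γ t)).trans_lt (hγ t)⟩,
    (hloss G).trans_lt hGc⟩
  rw [hsθ, Function.update_eq_self]

lemma exists_outputJoined_weight_apply_eq {k : ℕ} (hk : k + 1 < L)
    (hθ : Function.Surjective (layerOutput e X θ k (Nat.lt_of_succ_lt hk).le).mulVec)
    (hn : n (k + 2) < n (k + 1)) :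
    ∃ i, ∀ j r, ∃ θ', OutputJoined e X θ θ' ∧ weight θ' (k + 1) hk i j = r := by
  have hrange : LinearMap.range (weight θ (k + 1) hk).mulVecLin ≠ ⊤ := fun h => by
    have := LinearMap.finrank_range_le (weight θ (k + 1) hk).mulVecLin
    rw [h, finrank_top, Module.finrank_fin_fun, Module.finrank_fin_fun] at this
    exact hn.not_ge this
  obtain ⟨y, hy⟩ := SetLike.exists_not_mem_of_ne_top _ hrange rfl
  obtain ⟨i, hi⟩ : ∃ i, y i ≠ 0 :=
    Function.ne_iff.1 fun h => hy (h ▸ Submodule.zero_mem _)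
  refine ⟨i, fun j r => ?_⟩
  obtain ⟨p, hp⟩ := exists_outputJoined_addWeight θ k.lt_succ_self hk hθ
    (fun _ _ _ _ => by omega)
    (disjoint_range_vecMulVec hy fun _ => (r - weight θ (k + 1) hk i j) / y i)
  refine ⟨_, hp, ?_⟩
  rw [weight_update_addWeight, ← weight, Matrix.add_apply, vecMulVec_apply, mul_div_cancel₀ _ hi,
    add_sub_cancel]

lemma norm_weight_apply_le (θ : Params L n) {l : ℕ} (hl : l < L) (i : Fin (n l))
    (j : Fin (n (l + 1))) : ‖weight θ l hl i j‖ ≤ ‖θ‖ :=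
  calc ‖weight θ l hl i j‖ ≤ ‖(θ ⟨l, hl⟩).1 i‖ := norm_le_pi_norm ((θ ⟨l, hl⟩).1 i) j
    _ ≤ ‖(θ ⟨l, hl⟩).1‖ := norm_le_pi_norm (θ ⟨l, hl⟩).1 i
    _ ≤ ‖θ ⟨l, hl⟩‖ := norm_fst_le _
    _ ≤ ‖θ‖ := norm_le_pi_norm θ _

lemma IsLocalValley.not_isBounded (hC : IsLocalValley (trainLoss e X φ) C) (hθC : θ ∈ C)
    {k : ℕ} (hk : k + 1 < L)
    (hθ : Function.Surjective (layerOutput e X θ k (Nat.lt_of_succ_lt hk).le).mulVec)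
    (hn₀ : 0 < n (k + 2)) (hn : n (k + 2) < n (k + 1)) : ¬ Bornology.IsBounded C := by
  intro hbdd
  obtain ⟨M, hM⟩ := isBounded_iff_forall_norm_le.1 hbdd
  obtain ⟨i, hi⟩ := exists_outputJoined_weight_apply_eq hk hθ hn
  obtain ⟨θ', hjoin, hθ'⟩ := hi ⟨0, hn₀⟩ (M + 1)
  have hle := (norm_weight_apply_le θ' hk i ⟨0, hn₀⟩).trans
    (hM θ' (hC.mem_of_outputJoined hθC hjoin))
  rw [hθ', Real.norm_eq_abs] at hle
  linarith [le_abs_self (M + 1)]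

end TrainLoss

end NeuralLoss

theorem theorem2_general (L N : ℕ) (n : ℕ → ℕ) (hn : ∀ l ≤ L, 0 < n l)
    (σ : ℝ → ℝ) (hσ₁ : NeuralLoss.StrictlyMonotonicOnto σ)
    (hσ₂ : NeuralLoss.NoShiftDependence σ)
    (X : Matrix (Fin N) (Fin (n 0)) ℝ) (hX : Function.Injective fun i : Fin N => X i)
    (φ : Matrix (Fin N) (Fin (n L)) ℝ → ℝ) (hφ : Continuous φ)
    (k : ℕ) (hk₁ : 1 ≤ k) (hkL : k + 1 ≤ L) (hkN : N ≤ n k) :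
    ((∀ D, ¬ NeuralLoss.IsBadLocalValley φ (NeuralLoss.optValue φ) D) →
      (∀ l, k + 1 ≤ l → l + 1 ≤ L → n (l + 1) ≤ n l) →
      ∀ C : Set (NeuralLoss.Params L n),
        ¬ NeuralLoss.IsBadLocalValley (NeuralLoss.trainLoss σ X φ) (NeuralLoss.optValue φ) C) ∧
    (k + 2 ≤ L → n (k + 2) < n (k + 1) → ∀ C : Set (NeuralLoss.Params L n),
      NeuralLoss.IsLocalValley (NeuralLoss.trainLoss σ X φ) C → ¬ Bornology.IsBounded C) := by
  obtain ⟨e, rfl⟩ := hσ₁.exists_homeomorph_coe_eq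
  obtain ⟨l, rfl⟩ := Nat.exists_eq_add_of_le' hk₁
  have hsurj {C : Set (NeuralLoss.Params L n)}
      (hC : NeuralLoss.IsLocalValley (NeuralLoss.trainLoss e X φ) C) :=
    hC.exists_mem_surjective_mulVec hσ₂ hφ hX hkL (fun j hj => hn _ (by omega)) hkN
  refine ⟨fun hφ' hdec C ⟨hC, hbad⟩ => ?_, fun hL hlt C hC => ?_⟩
  · obtain ⟨θ, hθC, hθ⟩ := hsurj hC
    obtain ⟨θ', hjoin, hθ', hW⟩ :=
      NeuralLoss.exists_outputJoined_injective_weight θ hkL le_rfl hθ hdec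
    exact hbad (hC.arbitrarilyClose (hC.mem_of_outputJoined hθC hjoin) hkL (hθ' ▸ hθ)
      (fun j hj hkj => hW j hj hkj hj) hφ')
  · obtain ⟨θ, hθC, hθ⟩ := hsurj hC
    exact hC.not_isBounded hθC hL hθ (hn _ hL) hlt

theorem theorem2 (L N : ℕ) (n : ℕ → ℕ) (hn : ∀ l ≤ L, 0 < n l)
    (σ : ℝ → ℝ) (hσ₁ : NeuralLoss.StrictlyMonotonicOnto σ)
    (hσ₂ : NeuralLoss.NoShiftDependence σ)
    (X : Matrix (Fin N) (Fin (n 0)) ℝ) (hX : Function.Injective fun i : Fin N => X i)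
    (φ : Matrix (Fin N) (Fin (n L)) ℝ → ℝ) (hφ : ConvexOn ℝ Set.univ φ)
    (k : ℕ) (hk₁ : 1 ≤ k) (hkL : k + 1 ≤ L) (hkN : N ≤ n k)
    (hdec : ∀ l, k + 1 ≤ l → l + 1 ≤ L → n (l + 1) < n l) :
    (∀ C : Set (NeuralLoss.Params L n),
      ¬ NeuralLoss.IsBadLocalValley (NeuralLoss.trainLoss σ X φ) (NeuralLoss.optValue φ) C) ∧
    (k + 2 ≤ L → ∀ C : Set (NeuralLoss.Params L n),
      NeuralLoss.IsLocalValley (NeuralLoss.trainLoss σ X φ) C → ¬ Bornology.IsBounded C) := by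
  have h := theorem2_general L N n hn σ hσ₁ hσ₂ X hX φ (continuousOn_univ.1
    (ConvexOn.continuousOn (E := Fin N → Fin (n L) → ℝ) isOpen_univ hφ)) k hk₁ hkL hkN
  exact ⟨h.1 (fun _ => NeuralLoss.not_isBadLocalValley_of_convexOn hφ) fun l hl hlL =>
    (hdec l hl hlL).le, fun hL => h.2 hL (hdec _ le_rfl hL)⟩
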